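/- Let $\mathbb{F}_q$ be a finite field and let $V$ be a non-zero finite-dimensional $\mathbb{F}_q$-vector space. Let $K_V$ be the field of quotients of the symmetric algebra of $V$ over $\mathbb{F}_q$. Let $R_V\subset K_V$ be the $\mathbb{F}_q$-subalgebra generated by the elements $\frac1v$ for all $v\in V\setminus\{0\}$, and let $RS_V\subset K_V$ be the $\mathbb{F}_q$-subalgebra generated by $R_V$ and $V$. Both are graded so that each non-zero $v\in V$ has degree $1$ (whenever it lies in the ring) and $\frac1v$ has degree $-1$. Put $Q_V:=\operatorname{Proj} R_V$ (with the sign of the grading inverted) and $\Omega_V:=\operatorname{Spec} RS_{V,0}$, where $RS_{V,0}$ is the degree $0$ part of $RS_V$; the inclusion $R_V\subset RS_V$ induces a morphism $\Omega_V\to Q_V$. For every non-zero subspace $V'\subset V$, the graded homomorphism $R_V\to R_{V'}$ which sends $\frac1v$ to $\frac1v$ if $v\in V'\setminus\{0\}$ and to $0$ if $v\in V\setminus V'$ (extension by zero of reciprocal maps) induces a morphism $Q_{V'}\to Q_V$, and hence a composite morphism $\Omega_{V'}\to Q_{V'}\to Q_V$. This composite is a locally closed embedding, and $\Omega_{V'}$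 is identified with its image. Then: (a) The scheme $Q_V$ is the set-theoretic disjoint union of the locally closed subschemes $\Omega_{V'}$ for all non-zero subspaces $V'$ of $V$. (b) The closure of $\Omega_{V'}$ in $Q_V$ is the union of the $\Omega_{W'}$ for all non-zero subspaces $W'$ of $V'$. -/

import Mathlib

universe u v

namespace ReciprocalVariety

open AlgebraicGeometry CategoryTheory

noncomputable section

variable (F : Type u) [Field F] (V : Type v) [AddCommGroup V] [Module F V]

/-- The field of quotients `K_V` of the symmetric algebra `S_V` of `V` over `F`. -/
def QuotField : Type max u v := FractionRing (SymmetricAlgebra F V)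

instance : Field (QuotField F V) :=
  inferInstanceAs (Field (FractionRing (SymmetricAlgebra F V)))

instance : Algebra (SymmetricAlgebra F V) (QuotField F V) :=
  inferInstanceAs (Algebra (SymmetricAlgebra F V) (FractionRing (SymmetricAlgebra F V)))

instance : Algebra F (QuotField F V) :=
  inferInstanceAs (Algebra F (FractionRing (SymmetricAlgebra F V)))

instance : IsScalarTower F (SymmetricAlgebra F V) (QuotField F V) :=
  inferInstanceAs (IsScalarTower F (SymmetricAlgebra F V) (FractionRing (SymmetricAlgebra F V)))

instance : IsFractionRing (SymmetricAlgebra F V) (QuotField F V) :=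
  inferInstanceAs (IsFractionRing (SymmetricAlgebra F V) (FractionRing (SymmetricAlgebra F V)))

/-- The inclusion of `V`, as the degree one part of `S_V`, into `K_V`. -/
def vec : V →ₗ[F] QuotField F V :=
  (IsScalarTower.toAlgHom F (SymmetricAlgebra F V) (QuotField F V)).toLinearMap ∘ₗ
    SymmetricAlgebra.ι F V

/-- The ring `R_V`: the `F`-subalgebra of `K_V` generated by `1/v` for all `v ∈ V ∖ {0}`. -/
def RecipRing : Subalgebra F (QuotField F V) :=
  Algebra.adjoin F {x | ∃ v : V, v ≠ 0 ∧ x = (vec F V v)⁻¹}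

instance : CommRing (RecipRing F V) := (RecipRing F V).toCommRing

instance : AddCommGroup (RecipRing F V) := inferInstance

instance : Module F (RecipRing F V) := inferInstance

variable {V} in
/-- The element `1/v` of `R_V`, for `v ≠ 0` (and by convention `0` for `v = 0`). -/
def recip (v : V) : RecipRing F V :=
  ⟨(vec F V v)⁻¹, by
    by_cases hv : v = 0
    · subst hv
      simp
    · exact Algebra.subset_adjoin ⟨v, hv, rfl⟩⟩

/-- The homogeneous part of `R_V` spanned by the products of `n` elements of the form `1/v`
with `v ∈ V ∖ {0}`. This is the part of degree `-n` when the elements of `V` have degree `1`;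
for the purpose of forming `Proj` the sign of the grading is inverted. -/
def recipGrading (n : ℕ) : Submodule F (RecipRing F V) :=
  (Submodule.span F {x | ∃ v : V, v ≠ 0 ∧ x = recip F v}) ^ n

/-! ### Auxiliary specialization of `K_V` into Laurent series -/

variable {F V}

theorem vec_ne_zero {v : V} (hv : v ≠ 0) : vec F V v ≠ 0 := by
  intro h
  have h1 : SymmetricAlgebra.ι F V v = 0 := by
    apply IsFractionRing.injective (SymmetricAlgebra F V) (QuotField F V)
    rw [map_zero]
    exact h
  apply hv
  rw [← Module.forall_dual_apply_eq_zero_iff F]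
  intro φ
  have := congrArg (SymmetricAlgebra.lift φ) h1
  simpa using this

theorem coe_recip (v : V) : (recip F v : QuotField F V) = (vec F V v)⁻¹ := rfl

theorem recip_zero : recip F (0 : V) = 0 := by
  ext
  simp [coe_recip]

theorem recip_mem (v : V) : recip F v ∈ recipGrading F V 1 := by
  rw [recipGrading, pow_one]
  by_cases hv : v = 0
  · subst hv
    rw [recip_zero]
    exact zero_mem _
  · exact Submodule.subset_span ⟨v, hv, rfl⟩

/-- The substitution `X ↦ T⁻¹` from polynomials to Laurent series. -/
def polyToLaurent (D : Type*) [Field D] : Polynomial D →+* LaurentSeries D :=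
  Polynomial.eval₂RingHom HahnSeries.C (HahnSeries.single (-1) 1)

theorem coeff_polyToLaurent {D : Type*} [Field D] (p : Polynomial D) (n : ℕ) :
    (polyToLaurent D p).coeff (-(n : ℤ)) = p.coeff n := by
  induction p using Polynomial.induction_on' with
  | add p q hp hq => simp [hp, hq]
  | monomial m a =>
    simp only [polyToLaurent, Polynomial.coe_eval₂RingHom, Polynomial.eval₂_monomial,
      HahnSeries.single_pow, Polynomial.coeff_monomial]
    simp [HahnSeries.C_apply, HahnSeries.single_mul_single, HahnSeries.coeff_single, eq_comm]

theorem polyToLaurent_injective {D : Type*} [Field D] :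
    Function.Injective (polyToLaurent D) := by
  intro p q h
  ext n
  rw [← coeff_polyToLaurent, h, coeff_polyToLaurent]

theorem lift_injective (g : V →ₗ[F] Polynomial (QuotField F V))
    (hg : ∀ v, (g v).eval 1 = vec F V v) :
    Function.Injective (SymmetricAlgebra.lift g) := by
  have h : ((Polynomial.aeval (R := QuotField F V) (1 : QuotField F V)).restrictScalars F).comp
      (SymmetricAlgebra.lift g) =
      IsScalarTower.toAlgHom F (SymmetricAlgebra F V) (QuotField F V) := by
    apply SymmetricAlgebra.algHom_ext
    ext v
    simpa [Polynomial.aeval_def, Polynomial.eval₂_eq_eval_map] using! hg v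
  have h2 : Function.Injective
      (((Polynomial.aeval (R := QuotField F V) (1 : QuotField F V)).restrictScalars F).comp
      (SymmetricAlgebra.lift g)) := by
    rw [h]
    exact IsFractionRing.injective (SymmetricAlgebra F V) (QuotField F V)
  intro x y hxy
  apply h2
  simp [hxy]

/-- The homomorphism `K_V → K_V((T))` given by `v ↦ g(v)(T⁻¹)`, for a linear family of polynomials
`g(v)` with `g(v)(1) = v`. -/
def toLaurent (g : V →ₗ[F] Polynomial (QuotField F V)) (hg : ∀ v, (g v).eval 1 = vec F V v) :
    QuotField F V →+* LaurentSeries (QuotField F V) :=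
  IsFractionRing.lift (A := SymmetricAlgebra F V)
    (g := (polyToLaurent (QuotField F V)).comp (SymmetricAlgebra.lift g).toRingHom)
    (polyToLaurent_injective.comp (lift_injective g hg))

theorem toLaurent_vec (g : V →ₗ[F] Polynomial (QuotField F V))
    (hg : ∀ v, (g v).eval 1 = vec F V v) (v : V) :
    toLaurent g hg (vec F V v) = polyToLaurent _ (g v) := by
  refine (IsFractionRing.lift_algebraMap _ _).trans ?_
  simp

theorem toLaurent_algebraMap (g : V →ₗ[F] Polynomial (QuotField F V))
    (hg : ∀ v, (g v).eval 1 = vec F V v) (a : F) :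
    toLaurent g hg (algebraMap F _ a) = HahnSeries.C (algebraMap F _ a) := by
  rw [IsScalarTower.algebraMap_apply F (SymmetricAlgebra F V) (QuotField F V)]
  refine (IsFractionRing.lift_algebraMap _ _).trans ?_
  simp [polyToLaurent, Polynomial.algebraMap_apply]
  rfl

/-! ### The grading -/

/-- `v ↦ v · T⁻¹`. -/
def scalePoly : V →ₗ[F] Polynomial (QuotField F V) :=
  ((Polynomial.monomial 1).restrictScalars F) ∘ₗ vec F V

theorem scalePoly_eval (v : V) : (scalePoly (F := F) v).eval 1 = vec F V v := by
  simp [scalePoly]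

theorem toLaurent_scale_recip (v : V) :
    toLaurent scalePoly scalePoly_eval (recip F v : QuotField F V) =
      HahnSeries.single 1 (recip F v : QuotField F V) := by
  rw [coe_recip, map_inv₀, toLaurent_vec]
  simp [scalePoly, polyToLaurent, HahnSeries.C_apply, HahnSeries.single_mul_single]

theorem toLaurent_scale_mem {n : ℕ} {x : RecipRing F V} (hx : x ∈ recipGrading F V n) :
    toLaurent scalePoly scalePoly_eval (x : QuotField F V) =
      HahnSeries.single (n : ℤ) (x : QuotField F V) := by
  unfold recipGrading at hx
  induction hx using Submodule.pow_induction_on_left' with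
  | algebraMap a =>
    exact toLaurent_algebraMap _ _ a
  | add x y i hx hy ihx ihy => simp [ihx, ihy]
  | mem_mul m hm i x hx ih =>
    have hm' : toLaurent scalePoly scalePoly_eval (m : QuotField F V) =
      HahnSeries.single 1 (m : QuotField F V) := by
      induction hm using Submodule.span_induction with
      | mem x hx =>
        obtain ⟨v, -, rfl⟩ := hx
        exact toLaurent_scale_recip v
      | zero => simp
      | add x y _ _ ihx ihy => simp [ihx, ihy]
      | smul a x _ ih =>
        have : ((a • x : RecipRing F V) : QuotField F V) = algebraMap F _ a * x := by
          simp [Algebra.smul_def]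
        rw [this, map_mul, ih, toLaurent_algebraMap]
        simp [HahnSeries.C_apply, HahnSeries.single_mul_single]
    simp only [MulMemClass.coe_mul, map_mul, ih, hm', HahnSeries.single_mul_single]
    rw [show ((i.succ : ℕ) : ℤ) = 1 + (i : ℤ) by push_cast; ring]

instance recipGrading_gradedMonoid : SetLike.GradedMonoid (recipGrading F V) :=
  Submodule.nat_power_gradedMonoid _

theorem recipGrading_isInternal : DirectSum.IsInternal (recipGrading F V) := by
  classical
  constructor
  · rw [injective_iff_map_eq_zero]
    intro d hd
    have key : ∀ (d : DirectSum ℕ fun n => recipGrading F V n) (n : ℕ),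
        (toLaurent scalePoly scalePoly_eval
          ((DirectSum.coeAddMonoidHom (recipGrading F V) d : RecipRing F V) :
            QuotField F V)).coeff (n : ℤ) = ((d n : RecipRing F V) : QuotField F V) := by
      intro d n
      induction d using DirectSum.induction_on with
      | zero => simp
      | of i x =>
        rw [DirectSum.coeAddMonoidHom_of, toLaurent_scale_mem x.2, HahnSeries.coeff_single]
        by_cases h : i = n
        · subst h
          simp
        · rw [DirectSum.of_eq_of_ne _ _ _ (Ne.symm h), if_neg (by exact_mod_cast Ne.symm h)]
          simp
      | add x y hx hy => simp [hx, hy]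
    ext n
    rw [← key d n, hd]
    simp
  · have hmem : ∀ n (x : RecipRing F V), x ∈ recipGrading F V n →
        x ∈ AddMonoidHom.mrange (DirectSum.coeAddMonoidHom (recipGrading F V)) := fun n x hx =>
      ⟨DirectSum.of (fun n => recipGrading F V n) n ⟨x, hx⟩, by simp⟩
    rintro ⟨x, hx⟩
    change (⟨x, hx⟩ : RecipRing F V) ∈
      AddMonoidHom.mrange (DirectSum.coeAddMonoidHom (recipGrading F V))
    unfold RecipRing at hx
    induction hx using Algebra.adjoin_induction with
    | mem x hx =>
      obtain ⟨v, hv, rfl⟩ := hx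
      exact hmem 1 _ (recip_mem v)
    | algebraMap a =>
      exact hmem 0 (algebraMap F (RecipRing F V) a) (SetLike.algebraMap_mem_graded _ a)
    | add x y hx hy ihx ihy => exact add_mem ihx ihy
    | mul x y hx hy ihx ihy =>
      obtain ⟨a, ha⟩ := ihx
      obtain ⟨b, hb⟩ := ihy
      refine ⟨a * b, ?_⟩
      have := map_mul (DirectSum.coeRingHom (recipGrading F V)) a b
      refine this.trans ?_
      exact congrArg₂ (· * ·) ha hb

instance recipGrading_gradedAlgebra : GradedAlgebra (recipGrading F V) where
  toDecomposition := recipGrading_isInternal.chooseDecomposition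

/-! ### Extension by zero -/

/-- `v ↦ p(v) + (v - p(v)) · T⁻¹` for a linear endomorphism `p` of `V`. -/
def splitPoly (p : V →ₗ[F] V) : V →ₗ[F] Polynomial (QuotField F V) :=
  ((Polynomial.monomial 0).restrictScalars F) ∘ₗ vec F V ∘ₗ p +
    ((Polynomial.monomial 1).restrictScalars F) ∘ₗ vec F V ∘ₗ (LinearMap.id - p)

theorem splitPoly_eval (p : V →ₗ[F] V) (v : V) : (splitPoly p v).eval 1 = vec F V v := by
  simp [splitPoly]

open Classical in
theorem toLaurent_split_recip (p : V →ₗ[F] V) (v : V) :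
    ∃ f : PowerSeries (QuotField F V),
      toLaurent (splitPoly p) (splitPoly_eval p) (recip F v : QuotField F V) =
        HahnSeries.ofPowerSeries ℤ _ f ∧
      PowerSeries.constantCoeff f = if p v = v then (recip F v : QuotField F V) else 0 := by
  have h0 : toLaurent (splitPoly p) (splitPoly_eval p) (vec F V v) =
      HahnSeries.C (vec F V (p v)) + HahnSeries.single (-1) (vec F V (v - p v)) := by
    rw [toLaurent_vec]
    simp [splitPoly, polyToLaurent, HahnSeries.C_apply, HahnSeries.single_mul_single]
  rw [coe_recip, map_inv₀, h0]
  split_ifs with hpv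
  · refine ⟨PowerSeries.C (vec F V v)⁻¹, ?_, by simp⟩
    simp [hpv, HahnSeries.ofPowerSeries_C]
  · have hne : vec F V (v - p v) ≠ 0 := vec_ne_zero (sub_ne_zero.mpr (Ne.symm hpv))
    let w : PowerSeries (QuotField F V) :=
      PowerSeries.C (vec F V (v - p v)) + PowerSeries.X * PowerSeries.C (vec F V (p v))
    have hw : PowerSeries.constantCoeff w ≠ 0 := by simpa [w] using! hne
    refine ⟨PowerSeries.X * w⁻¹, ?_, by simp⟩
    apply inv_eq_of_mul_eq_one_right
    have h1 : HahnSeries.C (vec F V (p v)) + HahnSeries.single (-1) (vec F V (v - p v)) =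
        HahnSeries.single (-1) 1 * HahnSeries.ofPowerSeries ℤ _ w := by
      simp only [w, map_add, map_mul, HahnSeries.ofPowerSeries_C, HahnSeries.ofPowerSeries_X,
        mul_add, ← mul_assoc, HahnSeries.single_mul_single, HahnSeries.C_apply]
      simp only [neg_add_cancel, add_zero, mul_one, one_mul]
      exact add_comm _ _
    rw [h1, mul_assoc, ← map_mul, mul_left_comm, PowerSeries.mul_inv_cancel _ hw, mul_one,
      HahnSeries.ofPowerSeries_X, HahnSeries.single_mul_single]
    simp

open Classical in
/-- For a linear endomorphism `p` of `V`, there is a homomorphism on `R_V` which sends `1/v`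
to `1/v` if `p v = v` and to `0` otherwise. -/
theorem exists_specialization (p : V →ₗ[F] V) :
    ∃ φ : RecipRing F V →ₐ[F] QuotField F V,
      ∀ v, φ (recip F v) = if p v = v then (recip F v : QuotField F V) else 0 := by
  have hmem : ∀ x : RecipRing F V, ∃ f : PowerSeries (QuotField F V),
      toLaurent (splitPoly p) (splitPoly_eval p) (x : QuotField F V) =
        HahnSeries.ofPowerSeries ℤ _ f := by
    rintro ⟨x, hx⟩
    unfold RecipRing at hx
    induction hx using Algebra.adjoin_induction with
    | mem x hx =>
      obtain ⟨v, hv, rfl⟩ := hx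
      obtain ⟨f, hf, -⟩ := toLaurent_split_recip p v
      exact ⟨f, hf⟩
    | algebraMap a =>
      exact ⟨PowerSeries.C (algebraMap F _ a), by
        rw [HahnSeries.ofPowerSeries_C]
        exact toLaurent_algebraMap _ _ a⟩
    | add x y hx hy ihx ihy =>
      obtain ⟨f, hf⟩ := ihx
      obtain ⟨g, hg⟩ := ihy
      exact ⟨f + g, (map_add _ x y).trans ((congrArg₂ _ hf hg).trans (map_add _ f g).symm)⟩
    | mul x y hx hy ihx ihy =>
      obtain ⟨f, hf⟩ := ihx
      obtain ⟨g, hg⟩ := ihy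
      exact ⟨f * g, (map_mul _ x y).trans ((congrArg₂ _ hf hg).trans (map_mul _ f g).symm)⟩
  choose f hf using hmem
  have hinj : Function.Injective (HahnSeries.ofPowerSeries ℤ (QuotField F V)) :=
    HahnSeries.ofPowerSeries_injective
  refine ⟨{
    toFun := fun x => PowerSeries.constantCoeff (f x)
    map_one' := ?_
    map_mul' := ?_
    map_zero' := ?_
    map_add' := ?_
    commutes' := ?_ }, ?_⟩
  · rw [show f 1 = 1 from hinj (by rw [← hf]; simp), map_one]
  · intro x y
    rw [show f (x * y) = f x * f y from hinj (by rw [map_mul, ← hf, ← hf, ← hf]; simp), map_mul]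
  · rw [show f 0 = 0 from hinj (by rw [← hf]; simp), map_zero]
  · intro x y
    rw [show f (x + y) = f x + f y from hinj (by rw [map_add, ← hf, ← hf, ← hf]; simp), map_add]
  · intro a
    have : f (algebraMap F _ a) = PowerSeries.C (algebraMap F _ a) := by
      apply hinj
      rw [← hf, HahnSeries.ofPowerSeries_C]
      exact toLaurent_algebraMap _ _ a
    rw [this, PowerSeries.constantCoeff_C]
  · intro v
    obtain ⟨g, hg, hg0⟩ := toLaurent_split_recip p v
    have : f (recip F v) = g := hinj (by rw [← hf, hg])
    simpa [this] using! hg0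

/-- The inclusion `K_{V'} → K_V` for a subspace `V'` of `V`. -/
theorem exists_quotField_map (V' : Submodule F V) :
    ∃ j : QuotField F V' →ₐ[F] QuotField F V, ∀ w : V', j (vec F V' w) = vec F V w := by
  obtain ⟨p, hp⟩ := V'.subtype.exists_leftInverse_of_injective (by simp)
  let g := SymmetricAlgebra.lift (SymmetricAlgebra.ι F V ∘ₗ V'.subtype)
  let h := SymmetricAlgebra.lift (SymmetricAlgebra.ι F V' ∘ₗ p)
  have hgh : h.comp g = AlgHom.id F _ := by
    apply SymmetricAlgebra.algHom_ext
    ext w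
    have : p (w : V) = w := LinearMap.congr_fun hp w
    simp [g, h, this]
  have hg : Function.Injective g := fun x y hxy => by
    have := congrArg h hxy
    rwa [← AlgHom.comp_apply, ← AlgHom.comp_apply, hgh] at this
  have hinj : Function.Injective
      ((IsScalarTower.toAlgHom F (SymmetricAlgebra F V) (QuotField F V)).comp g) :=
    (IsFractionRing.injective (SymmetricAlgebra F V) (QuotField F V)).comp hg
  refine ⟨IsFractionRing.liftAlgHom (K := QuotField F V') hinj, fun w => ?_⟩
  refine (IsFractionRing.lift_algebraMap hinj _).trans ?_
  simp [g, vec]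

open Classical in
theorem exists_recipRestrict (V' : Submodule F V) :
    ∃ φ : RecipRing F V →ₐ[F] RecipRing F V',
      ∀ v, φ (recip F v) = if hv : v ∈ V' then recip F (⟨v, hv⟩ : V') else 0 := by
  obtain ⟨j, hj⟩ := exists_quotField_map V'
  obtain ⟨p, hp⟩ := V'.subtype.exists_leftInverse_of_injective (by simp)
  obtain ⟨φ, hφ⟩ := exists_specialization (V'.subtype ∘ₗ p)
  have hpv (v : V) : (V'.subtype ∘ₗ p) v = v ↔ v ∈ V' := by
    constructor
    · intro h
      rw [← h]
      simp
    · intro h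
      have : p v = ⟨v, h⟩ := LinearMap.congr_fun hp ⟨v, h⟩
      simp [this]
  have hφ' (v : V) : φ (recip F v) =
      j ((if hv : v ∈ V' then recip F (⟨v, hv⟩ : V') else 0 : RecipRing F V') :
        QuotField F V') := by
    rw [hφ, if_congr (hpv v) rfl rfl]
    by_cases hv : v ∈ V'
    · simp [hv, coe_recip, hj]
    · simp [hv]
  let ψ : RecipRing F V' →ₐ[F] QuotField F V := j.comp (RecipRing F V').val
  have hψ : Function.Injective ψ := j.toRingHom.injective.comp Subtype.val_injective
  have hr : ∀ x, φ x ∈ ψ.range := by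
    rintro ⟨x, hx⟩
    unfold RecipRing at hx
    induction hx using Algebra.adjoin_induction with
    | mem x hx =>
      obtain ⟨v, hv, rfl⟩ := hx
      exact ⟨_, (hφ' v).symm⟩
    | algebraMap a => exact ⟨algebraMap F _ a, (ψ.commutes a).trans (φ.commutes a).symm⟩
    | add x y hx hy ihx ihy =>
      obtain ⟨a, ha⟩ := ihx
      obtain ⟨b, hb⟩ := ihy
      exact ⟨a + b, (map_add ψ a b).trans ((congrArg₂ _ ha hb).trans (map_add φ _ _).symm)⟩
    | mul x y hx hy ihx ihy =>
      obtain ⟨a, ha⟩ := ihx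
      obtain ⟨b, hb⟩ := ihy
      exact ⟨a * b, (map_mul ψ a b).trans ((congrArg₂ _ ha hb).trans (map_mul φ _ _).symm)⟩
  refine ⟨((AlgEquiv.ofInjective ψ hψ).symm : ψ.range →ₐ[F] _).comp (φ.codRestrict ψ.range hr),
    fun v => ?_⟩
  apply hψ
  have := (AlgEquiv.ofInjective ψ hψ).apply_symm_apply ((φ.codRestrict ψ.range hr) (recip F v))
  have := congrArg Subtype.val this
  exact this.trans (hφ' v)

/-- The homomorphism `R_V → R_{V'}` corresponding to extension by zero of reciprocal maps from
a subspace `V'` to `V`: it is determined by `1/v ↦ 1/v` for `v ∈ V' ∖ {0}` and `1/v ↦ 0` for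
`v ∈ V ∖ V'`. -/
def recipRestrict (V' : Submodule F V) : RecipRing F V →ₐ[F] RecipRing F V' :=
  (exists_recipRestrict V').choose

open Classical in
theorem recipRestrict_recip (V' : Submodule F V) (v : V) :
    recipRestrict V' (recip F v) = if hv : v ∈ V' then recip F (⟨v, hv⟩ : V') else 0 :=
  (exists_recipRestrict V').choose_spec v

theorem recipRestrict_map_span (V' : Submodule F V) :
    (Submodule.span F {x | ∃ v : V, v ≠ 0 ∧ x = recip F v}).map (recipRestrict V').toLinearMap =
      Submodule.span F {x | ∃ v : V', v ≠ 0 ∧ x = recip F v} := by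
  apply le_antisymm
  · rw [Submodule.map_span, Submodule.span_le]
    rintro _ ⟨_, ⟨v, hv, rfl⟩, rfl⟩
    rw [AlgHom.toLinearMap_apply, recipRestrict_recip]
    split_ifs with h
    · exact Submodule.subset_span ⟨⟨v, h⟩, fun h0 => hv (congrArg Subtype.val h0), rfl⟩
    · exact zero_mem _
  · rw [Submodule.span_le]
    rintro _ ⟨⟨v, h⟩, hv, rfl⟩
    refine ⟨recip F v, Submodule.subset_span ⟨v, fun h0 => hv (Subtype.ext h0), rfl⟩, ?_⟩
    rw [AlgHom.toLinearMap_apply, recipRestrict_recip, dif_pos h]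

theorem recipRestrict_map (V' : Submodule F V) (n : ℕ) :
    (recipGrading F V n).map (recipRestrict V').toLinearMap = recipGrading F V' n := by
  rw [recipGrading, Submodule.map_pow, recipRestrict_map_span, recipGrading]

/-- `recipRestrict` as a homomorphism of graded rings. -/
def gradedRestrict (V' : Submodule F V) : recipGrading F V →+*ᵍ recipGrading F V' where
  toRingHom := (recipRestrict V').toRingHom
  map_mem {n x} hx := by
    rw [← recipRestrict_map]
    exact ⟨x, hx, rfl⟩

theorem irrelevant_le_map_gradedRestrict (V' : Submodule F V) :
    HomogeneousIdeal.irrelevant (recipGrading F V') ≤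
      (HomogeneousIdeal.irrelevant (recipGrading F V)).map (gradedRestrict V') := by
  rw [HomogeneousIdeal.irrelevant_le]
  intro i hi x hx
  rw [← recipRestrict_map] at hx
  obtain ⟨y, hy, rfl⟩ := hx
  exact Ideal.mem_map_of_mem (gradedRestrict V')
    (HomogeneousIdeal.mem_irrelevant_of_mem _ hi hy)

/-! ### The schemes -/

variable (F V)

/-- The scheme `Q_V = Proj R_V`. -/
abbrev QScheme : Scheme.{max u v} := Proj (recipGrading F V)

variable {F V} in
/-- The morphism `i_* : Q_{V'} → Q_V` given by extension by zero of reciprocal maps from a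
subspace `V'` to `V`. -/
def extendByZero (V' : Submodule F V) : QScheme F V' ⟶ QScheme F V :=
  Proj.map (gradedRestrict V') (irrelevant_le_map_gradedRestrict V')

/-- The homogeneous part of degree `n ∈ ℤ` of the subalgebra `RS_V` of `K_V` that is generated by
`V` and the reciprocals `1/v`: it is spanned by the products of `k` elements of `V` and `l`
elements of the form `1/v`, where `k - l = n`. -/
def locGrading (n : ℤ) : Submodule F (QuotField F V) :=
  ⨆ (k : ℕ) (l : ℕ) (_ : (k : ℤ) - l = n),
    LinearMap.range (vec F V) ^ k *
      Submodule.span F {x : QuotField F V | ∃ v : V, v ≠ 0 ∧ x = (vec F V v)⁻¹} ^ l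

variable {F V} in
theorem mem_locGrading {n : ℤ} (k l : ℕ) (h : (k : ℤ) - l = n) {x y : QuotField F V}
    (hx : x ∈ LinearMap.range (vec F V) ^ k)
    (hy : y ∈ Submodule.span F {x : QuotField F V | ∃ v : V, v ≠ 0 ∧ x = (vec F V v)⁻¹} ^ l) :
    x * y ∈ locGrading F V n :=
  le_iSup_of_le (f := fun k : ℕ => ⨆ (l : ℕ) (_ : (k : ℤ) - l = n),
    LinearMap.range (vec F V) ^ k *
      Submodule.span F {x : QuotField F V | ∃ v : V, v ≠ 0 ∧ x = (vec F V v)⁻¹} ^ l) k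
    (le_iSup₂_of_le l h le_rfl) (Submodule.mul_mem_mul hx hy)

instance locGrading_gradedMonoid : SetLike.GradedMonoid (locGrading F V) where
  one_mem := by
    rw [← mul_one (1 : QuotField F V)]
    exact mem_locGrading 0 0 (by simp) (by simp) (by simp)
  mul_mem := by
    intro m n x y hx hy
    suffices h : locGrading F V m * locGrading F V n ≤ locGrading F V (m + n) from
      h (Submodule.mul_mem_mul hx hy)
    simp only [locGrading, Submodule.iSup_mul, Submodule.mul_iSup, iSup_le_iff]
    intro k l hkl k' l' hkl'
    refine le_trans (le_of_eq ?_) (le_iSup_of_le (k' + k) (le_iSup₂_of_le (l' + l) ?_ le_rfl))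
    · rw [pow_add, pow_add]
      ring
    · push_cast
      linarith

/-- The ring `RS_{V,0}`: the part of degree `0` of `RS_V`. -/
def LocZero : Subalgebra F (QuotField F V) where
  carrier := locGrading F V 0
  mul_mem' {x y} hx hy := by simpa using SetLike.GradedMul.mul_mem (A := locGrading F V) hx hy
  add_mem' := add_mem
  algebraMap_mem' a := by
    rw [Algebra.algebraMap_eq_smul_one]
    exact Submodule.smul_mem _ _ SetLike.GradedOne.one_mem

instance : CommRing (LocZero F V) := (LocZero F V).toCommRing

/-- The affine scheme `Ω_V = Spec RS_{V,0}`. -/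
abbrev OmegaScheme : Scheme.{max u v} := Spec (.of (LocZero F V))

/-- The product of all elements `1/v` of `R_V` for `v ∈ V ∖ {0}`. -/
def recipProd : RecipRing F V := ∏ᶠ v : {v : V // v ≠ 0}, recip F v.1

variable {F V} in
theorem recipProd_ne_zero : recipProd F V ≠ 0 := by
  unfold recipProd
  refine finprod_induction (p := fun x => x ≠ 0) one_ne_zero (fun x y => mul_ne_zero) ?_
  rintro ⟨v, hv⟩ h
  exact inv_ne_zero (vec_ne_zero hv) (congrArg Subtype.val h)

theorem recipProd_mem [Finite F] [FiniteDimensional F V] :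
    recipProd F V ∈ recipGrading F V (Nat.card {v : V // v ≠ 0}) := by
  have : Finite V := Module.finite_of_finite F
  have := Fintype.ofFinite {v : V // v ≠ 0}
  rw [recipProd, finprod_eq_prod_of_fintype, Nat.card_eq_fintype_card, ← Finset.card_univ,
    Finset.card_eq_sum_ones]
  exact SetLike.prod_mem_graded (A := recipGrading F V) (fun _ => 1)
    (fun v : {v : V // v ≠ 0} => recip F v.1) fun v _ => recip_mem v.1

theorem card_pos [Finite F] [FiniteDimensional F V] [Nontrivial V] :
    0 < Nat.card {v : V // v ≠ 0} := by
  have : Finite V := Module.finite_of_finite F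
  obtain ⟨v, hv⟩ := exists_ne (0 : V)
  have : Nonempty {v : V // v ≠ 0} := ⟨⟨v, hv⟩⟩
  exact Nat.card_pos

variable {F V} in
theorem coe_mem_of_mem_recipGrading {n : ℕ} {x : RecipRing F V} (hx : x ∈ recipGrading F V n) :
    (x : QuotField F V) ∈
      Submodule.span F {x : QuotField F V | ∃ v : V, v ≠ 0 ∧ x = (vec F V v)⁻¹} ^ n := by
  have h : (recipGrading F V n).map (RecipRing F V).val.toLinearMap ≤
      Submodule.span F {x : QuotField F V | ∃ v : V, v ≠ 0 ∧ x = (vec F V v)⁻¹} ^ n := by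
    rw [recipGrading, Submodule.map_pow, Submodule.map_span]
    refine pow_le_pow_left' (Submodule.span_mono ?_) n
    rintro _ ⟨_, ⟨v, hv, rfl⟩, rfl⟩
    exact ⟨v, hv, rfl⟩
  exact h ⟨x, hx, rfl⟩

theorem inv_recipProd_mem [Finite F] [FiniteDimensional F V] :
    (recipProd F V : QuotField F V)⁻¹ ∈
      LinearMap.range (vec F V) ^ (Nat.card {v : V // v ≠ 0}) := by
  have : Finite V := Module.finite_of_finite F
  have := Fintype.ofFinite {v : V // v ≠ 0}
  have h : (recipProd F V : QuotField F V)⁻¹ = ∏ v : {v : V // v ≠ 0}, vec F V v.1 := by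
    rw [recipProd, finprod_eq_prod_of_fintype]
    simp [coe_recip]
  rw [h, Nat.card_eq_fintype_card, ← Finset.card_univ, Finset.card_eq_sum_ones]
  have := Submodule.nat_power_gradedMonoid (LinearMap.range (vec F V))
  refine SetLike.prod_mem_graded (A := fun n : ℕ => LinearMap.range (vec F V) ^ n) (fun _ => 1)
    (fun v : {v : V // v ≠ 0} => vec F V v.1) fun v _ => ?_
  rw [pow_one]
  exact ⟨v.1, rfl⟩

/-- The homomorphism from the degree zero part of the localization of `R_V` at `recipProd` to
`K_V`. -/
def awayToQuotField :
    HomogeneousLocalization.Away (recipGrading F V) (recipProd F V) →+* QuotField F V :=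
  (IsLocalization.Away.lift (S := Localization.Away (recipProd F V)) (recipProd F V)
    (g := (RecipRing F V).val.toRingHom)
    (isUnit_iff_ne_zero.mpr fun h => recipProd_ne_zero (Subtype.ext h))).comp
    (algebraMap (HomogeneousLocalization.Away (recipGrading F V) (recipProd F V))
      (Localization.Away (recipProd F V)))

theorem awayToQuotField_mem [Finite F] [FiniteDimensional F V]
    (x : HomogeneousLocalization.Away (recipGrading F V) (recipProd F V)) :
    awayToQuotField F V x ∈ LocZero F V := by
  obtain ⟨n, a, ha, rfl⟩ :=
    HomogeneousLocalization.Away.mk_surjective _ (recipProd_mem F V) x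
  have h : awayToQuotField F V
      (HomogeneousLocalization.Away.mk (recipGrading F V) (recipProd_mem F V) n a ha) =
      ((recipProd F V : QuotField F V)⁻¹) ^ n * a := by
    have hne : (recipProd F V : QuotField F V) ≠ 0 :=
      fun h => recipProd_ne_zero (Subtype.ext h)
    rw [inv_pow, eq_inv_mul_iff_mul_eq₀ (pow_ne_zero _ hne)]
    simp only [awayToQuotField, RingHom.comp_apply, HomogeneousLocalization.algebraMap_apply,
      HomogeneousLocalization.Away.val_mk, Localization.mk_eq_mk']
    exact ((IsLocalization.lift_mk'_spec (S := Localization.Away (recipProd F V))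
      (M := Submonoid.powers (recipProd F V)) _ _ _ _).mp rfl).symm
  rw [h]
  refine mem_locGrading (n • Nat.card {v : V // v ≠ 0}) (n • Nat.card {v : V // v ≠ 0})
    (sub_self _) ?_ (coe_mem_of_mem_recipGrading ha)
  rw [smul_eq_mul, mul_comm, pow_mul]
  exact Submodule.pow_mem_pow _ (inv_recipProd_mem F V) n

/-- The inclusion of `R_V` into `RS_V` in degree zero: the degree zero part of the localization of
`R_V` at the product of all `1/v` maps to `RS_{V,0}`. -/
def awayToLocZero [Finite F] [FiniteDimensional F V] :
    HomogeneousLocalization.Away (recipGrading F V) (recipProd F V) →+* LocZero F V :=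
  (awayToQuotField F V).codRestrict (LocZero F V) (awayToQuotField_mem F V)

/-- The morphism `Ω_V → Q_V` induced by the inclusion of `R_V` into `RS_V`. -/
def omegaToQ [Finite F] [FiniteDimensional F V] [Nontrivial V] :
    OmegaScheme F V ⟶ QScheme F V :=
  Spec.map (CommRingCat.ofHom (awayToLocZero F V)) ≫
    Proj.awayι (recipGrading F V) (recipProd F V) (recipProd_mem F V) (card_pos F V)

variable {F V} in
/-- The composite `Ω_{V'} → Q_{V'} → Q_V` for a nonzero subspace `V'` of `V`. -/
def stratumMap [Finite F] [FiniteDimensional F V] (V' : Submodule F V) (hV' : V' ≠ ⊥) :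
    OmegaScheme F V' ⟶ QScheme F V :=
  haveI : Nontrivial V' := Submodule.nontrivial_iff_ne_bot.mpr hV'
  omegaToQ F V' ≫ extendByZero V'

variable {F V} in
/-- The stratum `Ω_{V'}` as a subset of `Q_V`, for a nonzero subspace `V'` of `V`. -/
def stratum [Finite F] [FiniteDimensional F V] (V' : {V' : Submodule F V // V' ≠ ⊥}) :
    Set (QScheme F V) :=
  Set.range (stratumMap V'.1 V'.2)

end

end ReciprocalVariety

open ReciprocalVariety

/-! A point `x` of `Q_V` is a homogeneous prime of `R_V`, and the whole argument reads it through
its `support`: the set of `v` for which `1/v` does not vanish at `x`, together with `0`. The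
relation `1/v · 1/w = 1/(v+w) · (1/v + 1/w)` makes it a subspace, and it is non-zero because the
`1/v` generate the irrelevant ideal. The theorem then reduces to two statements: `Ω_{V'}` consists
of the points with support equal to `V'` (`mem_stratum_iff`), and its closure of the points with
support contained in `V'` (`closure_stratum`).

For the former, `Ω_{V'} → Q_{V'}` is an open immersion onto the locus where no `1/v` vanishes, since
inverting all `1/v` in `R_{V'}` and taking degree zero gives exactly `RS_{V',0}`. Moreover `Q_{V'} →
Q_V` has image the points with support in `V'`: the surjection `R_V → R_{V'}` has a section
`recipExtend`, and going to `R_{V'}` and back is the identity modulo the `1/v` with `v ∉ V'`.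

For the latter, the points with support in `V'` form a zero locus, and each of them is a
specialization of the image of the generic point of `Q_{V'}`, which is the kernel of `R_V → R_{V'}`.
The immersion property follows because over a suitable basic open set of `Q_V` the map is `Spec` of
a surjection. -/

namespace ReciprocalVariety

open AlgebraicGeometry CategoryTheory HomogeneousLocalization

/-! ### Relations between reciprocals, and the section of `R_V → R_{V'}`. -/

section Algebra

variable {F : Type u} [Field F] {V : Type v} [AddCommGroup V] [Module F V]

theorem recip_ne_zero {v : V} (hv : v ≠ 0) : recip F v ≠ 0 := fun h =>
  inv_ne_zero (vec_ne_zero hv) (congrArg Subtype.val h)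

theorem recip_smul (a : F) (v : V) : recip F (a • v) = a⁻¹ • recip F v := by
  apply Subtype.ext
  change (vec F V (a • v))⁻¹ = a⁻¹ • (vec F V v)⁻¹
  rw [map_smul, Algebra.smul_def, Algebra.smul_def, mul_inv, map_inv₀]

/-- This is `1/v + 1/w = (v+w)/(vw)` cleared of denominators; it is the reason why supports are
closed under addition. It fails for `v + w = 0`, where `recip` takes its default value `0`. -/
theorem recip_mul_recip {v w : V} (hv : v ≠ 0) (hw : w ≠ 0) (hvw : v + w ≠ 0) :
    recip F v * recip F w = recip F (v + w) * (recip F v + recip F w) := by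
  apply Subtype.ext
  change (vec F V v)⁻¹ * (vec F V w)⁻¹ =
    (vec F V (v + w))⁻¹ * ((vec F V v)⁻¹ + (vec F V w)⁻¹)
  have h := vec_ne_zero (F := F) hvw
  have h1 := vec_ne_zero (F := F) hv
  have h2 := vec_ne_zero (F := F) hw
  rw [map_add] at h ⊢
  field_simp
  ring

/-- Generation is restated inside `R_V` itself, so that algebra homomorphisms out of `R_V` can be
compared on the `1/v`. -/
theorem adjoin_range_recip :
    Algebra.adjoin F (Set.range (recip F : V → RecipRing F V)) = ⊤ := by
  have h : ∀ x : QuotField F V, ∀ hx : x ∈ RecipRing F V,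
      (⟨x, hx⟩ : RecipRing F V) ∈ Algebra.adjoin F (Set.range (recip F : V → RecipRing F V)) := by
    intro x hx
    unfold RecipRing at hx
    induction hx using Algebra.adjoin_induction with
    | mem x hx =>
      obtain ⟨v, -, rfl⟩ := hx
      exact Algebra.subset_adjoin ⟨v, rfl⟩
    | algebraMap a => exact Subalgebra.algebraMap_mem _ a
    | add x y hx hy ihx ihy => exact add_mem ihx ihy
    | mul x y hx hy ihx ihy => exact mul_mem ihx ihy
  exact eq_top_iff.mpr fun x _ => h x x.2

/-- The inclusion `K_{V'} → K_V` carries generators of `R_{V'}` to generators of `R_V`. The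
resulting map is a section of `recipRestrict` and serves to lift elements and to pull back primes.
-/
theorem exists_recipExtend (V' : Submodule F V) :
    ∃ σ : RecipRing F V' →ₐ[F] RecipRing F V, ∀ w : V', σ (recip F w) = recip F (w : V) := by
  obtain ⟨j, hj⟩ := exists_quotField_map V'
  have hr : ∀ x : RecipRing F V', (j.comp (RecipRing F V').val) x ∈ RecipRing F V := by
    intro x
    have hx : x ∈ Algebra.adjoin F (Set.range (recip F : V' → RecipRing F V')) := by
      rw [adjoin_range_recip]; trivial
    have hle : Algebra.adjoin F (Set.range (recip F : V' → RecipRing F V')) ≤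
        (RecipRing F V).comap (j.comp (RecipRing F V').val) := by
      rw [Algebra.adjoin_le_iff]
      rintro _ ⟨w, rfl⟩
      change j (vec F V' w)⁻¹ ∈ RecipRing F V
      rw [map_inv₀, hj]
      exact (recip F (w : V)).2
    exact hle hx
  refine ⟨(j.comp (RecipRing F V').val).codRestrict _ hr, fun w => Subtype.ext ?_⟩
  change j (vec F V' w)⁻¹ = (vec F V (w : V))⁻¹
  rw [map_inv₀, hj]

/-- The inclusion `R_{V'} → R_V` for a subspace `V'` of `V`. -/
noncomputable def recipExtend (V' : Submodule F V) : RecipRing F V' →ₐ[F] RecipRing F V :=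
  (exists_recipExtend V').choose

theorem recipExtend_recip (V' : Submodule F V) (w : V') :
    recipExtend V' (recip F w) = recip F (w : V) :=
  (exists_recipExtend V').choose_spec w

theorem recipExtend_mem (V' : Submodule F V) {n : ℕ} {x : RecipRing F V'}
    (hx : x ∈ recipGrading F V' n) : recipExtend V' x ∈ recipGrading F V n := by
  have h : (recipGrading F V' n).map (recipExtend V').toLinearMap ≤ recipGrading F V n := by
    rw [recipGrading, Submodule.map_pow, Submodule.map_span]
    refine pow_le_pow_left' (Submodule.span_mono ?_) n
    rintro _ ⟨_, ⟨v, hv, rfl⟩, rfl⟩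
    exact ⟨v, fun h => hv (Subtype.ext h), recipExtend_recip V' v⟩
  exact h ⟨x, hx, rfl⟩

/-- `recipExtend` as a homomorphism of graded rings. -/
noncomputable def gradedExtend (V' : Submodule F V) :
    recipGrading F V' →+*ᵍ recipGrading F V where
  toRingHom := (recipExtend V').toRingHom
  map_mem hx := recipExtend_mem V' hx

theorem recipRestrict_recip_coe (V' : Submodule F V) (w : V') :
    recipRestrict V' (recip F (w : V)) = recip F w := by
  rw [recipRestrict_recip, dif_pos w.2]

theorem recipRestrict_recip_of_notMem (V' : Submodule F V) {v : V} (hv : v ∉ V') :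
    recipRestrict V' (recip F v) = 0 := by
  rw [recipRestrict_recip, dif_neg hv]

/-- The composite `R_V → R_{V'} → R_V` is the identity modulo the elements `1/v` for `v ∉ V'`. -/
theorem recipExtend_recipRestrict_sub_mem (V' : Submodule F V) (x : RecipRing F V) :
    recipExtend V' (recipRestrict V' x) - x ∈ Ideal.span (recip F '' (V' : Set V)ᶜ) := by
  let I : Ideal (RecipRing F V) := Ideal.span (recip F '' (V' : Set V)ᶜ)
  -- Both maps to the quotient are algebra homomorphisms, so it suffices to compare them on each
  -- `1/v`, separately for `v ∈ V'` and `v ∉ V'`.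
  have h : (Ideal.Quotient.mkₐ F I).comp ((recipExtend V').comp (recipRestrict V')) =
      Ideal.Quotient.mkₐ F I := by
    refine AlgHom.ext_of_adjoin_eq_top adjoin_range_recip ?_
    rintro _ ⟨v, rfl⟩
    by_cases hv : v ∈ V'
    · have := recipRestrict_recip_coe V' ⟨v, hv⟩
      simp only [AlgHom.comp_apply]
      rw [this, recipExtend_recip]
    · simp only [AlgHom.comp_apply, recipRestrict_recip_of_notMem V' hv, map_zero]
      exact (Ideal.Quotient.eq_zero_iff_mem.mpr (Ideal.subset_span (Set.mem_image_of_mem _ hv))).symm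
  exact Ideal.Quotient.eq.mp (AlgHom.congr_fun h x)

end Algebra

/-! ### Points of `Q_V`, their supports, and the image of `Q_{V'}`. -/

section Points

variable {F : Type u} [Field F] {V : Type v} [AddCommGroup V] [Module F V]

theorem exists_recip_notMem (x : ProjectiveSpectrum (recipGrading F V)) :
    ∃ v : V, v ≠ 0 ∧ recip F v ∉ x.asHomogeneousIdeal := by
  by_contra! h
  apply x.not_irrelevant_le
  rw [HomogeneousIdeal.irrelevant_le]
  intro i hi y hy
  obtain ⟨n, rfl⟩ := Nat.exists_eq_succ_of_ne_zero hi.ne'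
  -- Positive degree leaves at least one factor of degree `1`, which lies in the prime by
  -- assumption.
  have hle : recipGrading F V (n + 1) ≤
      x.asHomogeneousIdeal.toIdeal.restrictScalars F := by
    rw [recipGrading, pow_succ, Submodule.mul_le]
    intro a _ b hb
    have hb' : b ∈ x.asHomogeneousIdeal.toIdeal.restrictScalars F :=
      Submodule.span_le.mpr (by rintro _ ⟨v, hv, rfl⟩; exact h v hv) hb
    exact Ideal.mul_mem_left _ a hb'
  exact hle hy

/-- The subspace of `V` on which the reciprocal map corresponding to a point of `Q_V` is
non-zero. -/
def support (x : ProjectiveSpectrum (recipGrading F V)) : Submodule F V where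
  -- The clause `v ≠ 0` puts `0` into the support; `recip F 0 = 0` lies in every ideal.
  carrier := {v | v ≠ 0 → recip F v ∉ x.asHomogeneousIdeal}
  zero_mem' h := absurd rfl h
  add_mem' {v w} hv hw hvw hmem := by
    by_cases hv0 : v = 0
    · subst hv0
      rw [zero_add] at hvw hmem
      exact hw hvw hmem
    by_cases hw0 : w = 0
    · subst hw0
      rw [add_zero] at hvw hmem
      exact hv hvw hmem
    have h : recip F v * recip F w ∈ x.asHomogeneousIdeal.toIdeal := by
      rw [recip_mul_recip hv0 hw0 hvw]
      exact Ideal.mul_mem_right _ _ hmem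
    exact (x.isPrime.mem_or_mem h).elim (hv hv0) (hw hw0)
  smul_mem' a v hv hav hmem := by
    have ha : a ≠ 0 := fun h => hav (by rw [h, zero_smul])
    have hv0 : v ≠ 0 := fun h => hav (by rw [h, smul_zero])
    apply hv hv0
    have h : recip F v = algebraMap F (RecipRing F V) a * recip F (a • v) := by
      rw [recip_smul, ← Algebra.smul_def, smul_inv_smul₀ ha]
    rw [h]
    exact Ideal.mul_mem_left x.asHomogeneousIdeal.toIdeal _ hmem

theorem mem_support {x : ProjectiveSpectrum (recipGrading F V)} {v : V} (hv : v ≠ 0) :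
    v ∈ support x ↔ recip F v ∉ x.asHomogeneousIdeal :=
  ⟨fun h => h hv, fun h _ => h⟩

theorem support_ne_bot (x : ProjectiveSpectrum (recipGrading F V)) : support x ≠ ⊥ := by
  obtain ⟨v, hv, hvx⟩ := exists_recip_notMem x
  exact fun h => hv ((Submodule.eq_bot_iff _).mp h v ((mem_support hv).mpr hvx))

theorem recip_mem_of_notMem_support {x : ProjectiveSpectrum (recipGrading F V)} {v : V}
    (hv : v ∉ support x) : recip F v ∈ x.asHomogeneousIdeal := by
  by_contra h
  exact hv fun _ => h

theorem mem_extendByZero (V' : Submodule F V) (p : QScheme F V') (y : RecipRing F V) :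
    y ∈ (ProjectiveSpectrum.asHomogeneousIdeal (extendByZero V' p : QScheme F V)) ↔
      recipRestrict V' y ∈ ProjectiveSpectrum.asHomogeneousIdeal p :=
  Iff.rfl

theorem support_extendByZero_le (V' : Submodule F V) (p : QScheme F V') :
    support (extendByZero V' p : QScheme F V) ≤ V' := by
  intro v hv
  by_contra hvV'
  have hv0 : v ≠ 0 := fun h => hvV' (h ▸ zero_mem _)
  apply (mem_support hv0).mp hv
  rw [mem_extendByZero, recipRestrict_recip_of_notMem V' hvV']
  exact zero_mem p.asHomogeneousIdeal.toIdeal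

/-- All `1/v` with `v ∉ V'` lie in `x`, so membership in `x` is unchanged by passing through
`R_{V'}` and back. -/
theorem extend_restrict_sub_mem_of_support_le {V' : Submodule F V} {x : ProjectiveSpectrum (recipGrading F V)}
    (hx : support x ≤ V') {y : RecipRing F V} :
    recipExtend V' (recipRestrict V' y) - y ∈ x.asHomogeneousIdeal.toIdeal := by
  have h : Ideal.span (recip F '' (V' : Set V)ᶜ) ≤ x.asHomogeneousIdeal.toIdeal := by
    rw [Ideal.span_le]
    rintro _ ⟨v, hv, rfl⟩
    exact recip_mem_of_notMem_support fun h => hv (hx h)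
  exact h (recipExtend_recipRestrict_sub_mem V' y)

theorem exists_extendByZero_eq {V' : Submodule F V} {x : QScheme F V}
    (hx : support x ≤ V') : ∃ p : QScheme F V', extendByZero V' p = x := by
  obtain ⟨v, hv, hvx⟩ := exists_recip_notMem x
  have hvV' : v ∈ V' := hx ((mem_support hv).mpr hvx)
  -- The preimage of `x` is its contraction along the section; it is relevant because some `1/v`
  -- with `v ∈ V'` lies outside `x`.
  let p : ProjectiveSpectrum (recipGrading F V') :=
    { asHomogeneousIdeal := x.asHomogeneousIdeal.comap (gradedExtend V')
      isPrime := x.isPrime.comap (gradedExtend V')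
      not_irrelevant_le := fun h => by
        have h1 : recip F (⟨v, hvV'⟩ : V') ∈ HomogeneousIdeal.irrelevant (recipGrading F V') :=
          HomogeneousIdeal.mem_irrelevant_of_mem _ one_pos (recip_mem _)
        have h2 : recipExtend V' (recip F (⟨v, hvV'⟩ : V')) ∈ x.asHomogeneousIdeal := h h1
        rw [recipExtend_recip] at h2
        exact hvx h2 }
  refine ⟨p, ?_⟩
  apply ProjectiveSpectrum.ext
  apply HomogeneousIdeal.ext
  ext y
  change recipExtend V' (recipRestrict V' y) ∈ x.asHomogeneousIdeal.toIdeal ↔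
    y ∈ x.asHomogeneousIdeal.toIdeal
  have h := extend_restrict_sub_mem_of_support_le hx (y := y)
  exact ⟨fun h1 => by simpa using sub_mem h1 h, fun h1 => by simpa using add_mem h h1⟩

theorem recipProd_eq_prod [Fintype {v : V // v ≠ 0}] :
    recipProd F V = ∏ v : {v : V // v ≠ 0}, recip F v.1 := by
  rw [recipProd, finprod_eq_prod_of_fintype]

theorem isClosed_setOf_support_le (V' : Submodule F V) :
    IsClosed {x : QScheme F V | support x ≤ V'} := by
  have h : {x : QScheme F V | support x ≤ V'} =
      ProjectiveSpectrum.zeroLocus (recipGrading F V) (recip F '' (V' : Set V)ᶜ) := by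
    ext x
    constructor
    · rintro hx _ ⟨v, hv, rfl⟩
      exact recip_mem_of_notMem_support fun h => hv (hx h)
    · intro hx v hv
      by_contra hvV'
      exact hv (fun h => hvV' (h ▸ zero_mem _)) (hx ⟨v, hvV', rfl⟩)
  rw [h]
  exact ProjectiveSpectrum.isClosed_zeroLocus _ _

variable (F V) in
/-- The generic point of `Q_V`. -/
noncomputable def genericPoint [Nontrivial V] : QScheme F V where
  asHomogeneousIdeal := ⊥
  isPrime := by
    rw [HomogeneousIdeal.toIdeal_bot]
    exact Ideal.isPrime_bot
  not_irrelevant_le h := by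
    obtain ⟨v, hv⟩ := exists_ne (0 : V)
    exact recip_ne_zero hv
      (h (HomogeneousIdeal.mem_irrelevant_of_mem _ one_pos (recip_mem (F := F) v)))

/-- `R_V → R_{V'}` is onto in each degree, so numerators lift without changing degree. -/
theorem awayMap_gradedRestrict_surjective (V' : Submodule F V) {n : ℕ} {s : RecipRing F V}
    (hs : s ∈ recipGrading F V n) :
    Function.Surjective (Away.map (gradedRestrict V') s) := by
  intro y
  obtain ⟨m, a, ha, rfl⟩ := Away.mk_surjective _ ((gradedRestrict V').map_mem hs) y
  have ha' := ha
  rw [← recipRestrict_map] at ha'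
  obtain ⟨b, hb, rfl⟩ := ha'
  exact ⟨Away.mk _ hs m b hb, Away.map_mk _ _ _ _ _ _⟩

theorem isImmersion_of_isClosedImmersion_comp {X Y Z : Scheme} {f : X ⟶ Y} {g : Y ⟶ Z}
    (hf : IsClosedImmersion f) (hg : IsOpenImmersion g) : IsImmersion (f ≫ g) :=
  inferInstance

/-- For any homogeneous lift `s` of `t`, the map from the basic open set of `t` factors as a closed
immersion into that of `s`, followed by an open immersion into `Q_V`. -/
theorem isImmersion_awayι_extendByZero (V' : Submodule F V) {n : ℕ} (hn : 0 < n)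
    {s : RecipRing F V} (hs : s ∈ recipGrading F V n) {t : RecipRing F V'}
    (ht : t ∈ recipGrading F V' n) (hst : recipRestrict V' s = t) :
    IsImmersion (Proj.awayι (recipGrading F V') t ht hn ≫ extendByZero V') := by
  subst hst
  have : IsClosedImmersion (Spec.map (CommRingCat.ofHom (Away.map (gradedRestrict V') s))) :=
    IsClosedImmersion.spec_of_surjective _ (awayMap_gradedRestrict_surjective V' hs)
  have h := Proj.awayι_comp_map (gradedRestrict V') (irrelevant_le_map_gradedRestrict V') hn s hs
  exact h ▸ isImmersion_of_isClosedImmersion_comp this inferInstance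

end Points

/-! ### Identification of `Ω_V` with a basic open set, and the strata with their closures. -/

section Strata

variable {F : Type u} [Field F] [Finite F] {V : Type v} [AddCommGroup V] [Module F V]
  [FiniteDimensional F V]

theorem recipProd_notMem_iff (x : ProjectiveSpectrum (recipGrading F V)) :
    recipProd F V ∉ x.asHomogeneousIdeal ↔ ∀ v : V, v ≠ 0 → recip F v ∉ x.asHomogeneousIdeal := by
  have : Finite V := Module.finite_of_finite F
  have := Fintype.ofFinite {v : V // v ≠ 0}
  have h := x.isPrime.prod_mem_iff (s := Finset.univ)
    (x := fun v : {v : V // v ≠ 0} => recip F v.1)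
  rw [recipProd_eq_prod]
  refine (not_congr h).trans ?_
  simp [HomogeneousIdeal.mem_iff]

theorem awayToQuotField_mk (n : ℕ) (a : RecipRing F V)
    (ha : a ∈ recipGrading F V (n • Nat.card {v : V // v ≠ 0})) :
    awayToQuotField F V (Away.mk (recipGrading F V) (recipProd_mem F V) n a ha) =
      ((recipProd F V : QuotField F V)⁻¹) ^ n * a := by
  have hne : (recipProd F V : QuotField F V) ≠ 0 :=
    fun h => recipProd_ne_zero (Subtype.ext h)
  rw [inv_pow, eq_inv_mul_iff_mul_eq₀ (pow_ne_zero _ hne)]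
  simp only [awayToQuotField, RingHom.comp_apply, HomogeneousLocalization.algebraMap_apply,
    Away.val_mk, Localization.mk_eq_mk']
  exact ((IsLocalization.lift_mk'_spec (S := Localization.Away (recipProd F V))
    (M := Submonoid.powers (recipProd F V)) _ _ _ _).mp rfl).symm

theorem awayToLocZero_injective : Function.Injective (awayToLocZero F V) := by
  rw [injective_iff_map_eq_zero]
  intro x hx
  obtain ⟨n, a, ha, rfl⟩ := Away.mk_surjective _ (recipProd_mem F V) x
  have h : awayToQuotField F V (Away.mk (recipGrading F V) (recipProd_mem F V) n a ha) = 0 :=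
    congrArg Subtype.val hx
  rw [awayToQuotField_mk, mul_eq_zero_iff_left] at h
  · obtain rfl : a = 0 := Subtype.ext h
    apply HomogeneousLocalization.val_injective
    simp [Away.val_mk, Localization.mk_zero]
  · exact pow_ne_zero _ (inv_ne_zero fun h => recipProd_ne_zero (Subtype.ext h))

variable (F V) in
/-- The image of the degree zero part of the localization of `R_V` at `recipProd` in `K_V`. -/
noncomputable def awayRange : Subalgebra F (QuotField F V) where
  __ := (awayToQuotField F V).range
  algebraMap_mem' a := by
    refine ⟨Away.mk (recipGrading F V) (recipProd_mem F V) 0 (algebraMap F _ a) ?_, ?_⟩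
    · rw [zero_smul]
      exact SetLike.algebraMap_mem_graded _ a
    · rw [awayToQuotField_mk]
      simp

theorem vec_mul_inv_mem_awayRange (v : V) {w : V} (hw : w ≠ 0) :
    vec F V v * (vec F V w)⁻¹ ∈ awayRange F V := by
  classical
  by_cases hv : v = 0
  · subst hv
    rw [map_zero, zero_mul]
    exact zero_mem _
  have : Finite V := Module.finite_of_finite F
  have := Fintype.ofFinite {v : V // v ≠ 0}
  -- With `P` the product of all reciprocals except `1/v`, one has `v = P / recipProd`, so `v/w` is
  -- the fraction with numerator `1/w · P` and denominator `recipProd`.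
  let P : RecipRing F V := ∏ u ∈ Finset.univ.erase (⟨v, hv⟩ : {v : V // v ≠ 0}), recip F u.1
  have hP : recip F v * P = recipProd F V := by
    rw [recipProd_eq_prod]
    exact Finset.mul_prod_erase Finset.univ (fun u : {v : V // v ≠ 0} => recip F u.1)
      (Finset.mem_univ (⟨v, hv⟩ : {v : V // v ≠ 0}))
  have hPmem : P ∈ recipGrading F V (Nat.card {v : V // v ≠ 0} - 1) := by
    rw [Nat.card_eq_fintype_card, ← Finset.card_univ,
      ← Finset.card_erase_of_mem (Finset.mem_univ (⟨v, hv⟩ : {v : V // v ≠ 0})),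
      Finset.card_eq_sum_ones]
    exact SetLike.prod_mem_graded (A := recipGrading F V) (fun _ => 1)
      (fun v : {v : V // v ≠ 0} => recip F v.1) fun v _ => recip_mem v.1
  have hcard : 0 < Nat.card {v : V // v ≠ 0} := by
    have : Nonempty {v : V // v ≠ 0} := ⟨⟨v, hv⟩⟩
    exact Nat.card_pos
  refine ⟨Away.mk (recipGrading F V) (recipProd_mem F V) 1 (recip F w * P) ?_, ?_⟩
  · have := SetLike.mul_mem_graded (A := recipGrading F V) (recip_mem (F := F) w) hPmem
    rwa [Nat.add_sub_cancel' hcard, ← one_smul ℕ (Nat.card _)] at this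
  · have hP0 : (P : QuotField F V) ≠ 0 := fun h =>
      recipProd_ne_zero (F := F) (V := V) (by rw [← hP, show P = 0 from Subtype.ext h, mul_zero])
    rw [awayToQuotField_mk, ← hP]
    simp only [MulMemClass.coe_mul, coe_recip, pow_one]
    have := vec_ne_zero (F := F) hv
    have := vec_ne_zero (F := F) hw
    field_simp

theorem locGrading_zero_le : locGrading F V 0 ≤ Subalgebra.toSubmodule (awayRange F V) := by
  simp only [locGrading, iSup_le_iff]
  intro k l hkl
  -- Degree zero means as many vectors as reciprocals, so they can be paired into quotients `v/w`.
  obtain rfl : k = l := by omega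
  rw [← mul_pow]
  have h : LinearMap.range (vec F V) *
      Submodule.span F {x : QuotField F V | ∃ v : V, v ≠ 0 ∧ x = (vec F V v)⁻¹} ≤
      Subalgebra.toSubmodule (awayRange F V) := by
    rw [← Submodule.span_eq (LinearMap.range (vec F V)), Submodule.span_mul_span,
      Submodule.span_le]
    refine Set.mul_subset_iff.mpr fun x hx y hy => ?_
    obtain ⟨v, rfl⟩ := hx
    obtain ⟨w, hw, rfl⟩ := hy
    exact vec_mul_inv_mem_awayRange v hw
  refine (pow_le_pow_left' h k).trans ?_
  clear hkl
  intro x hx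
  induction hx using Submodule.pow_induction_on_left' with
  | algebraMap a => exact Subalgebra.algebraMap_mem _ a
  | add x y i hx hy ihx ihy => exact add_mem ihx ihy
  | mem_mul m hm i x hx ih => exact mul_mem (S := Subalgebra F (QuotField F V)) hm ih

theorem awayToLocZero_surjective : Function.Surjective (awayToLocZero F V) := by
  rintro ⟨x, hx⟩
  obtain ⟨y, hy⟩ := locGrading_zero_le hx
  exact ⟨y, Subtype.ext hy⟩

instance : IsIso (Spec.map (CommRingCat.ofHom (awayToLocZero F V))) := by
  have : IsIso (CommRingCat.ofHom (awayToLocZero F V)) :=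
    (RingEquiv.ofBijective (awayToLocZero F V)
      ⟨awayToLocZero_injective, awayToLocZero_surjective⟩).toCommRingCatIso.isIso_hom
  infer_instance

instance [Nontrivial V] : IsOpenImmersion (omegaToQ F V) := by
  unfold omegaToQ
  infer_instance

theorem range_omegaToQ [Nontrivial V] :
    Set.range (omegaToQ F V) = (Proj.basicOpen (recipGrading F V) (recipProd F V) :
      Set (QScheme F V)) := by
  rw [← Proj.opensRange_awayι _ _ (recipProd_mem F V) (card_pos F V)]
  exact congrArg (fun U : (QScheme F V).Opens => (U : Set (QScheme F V)))
    (Scheme.Hom.opensRange_comp_of_isIso _ _)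

theorem isImmersion_stratumMap (V' : Submodule F V) (hV' : V' ≠ ⊥) :
    IsImmersion (stratumMap V' hV') := by
  have : Nontrivial V' := Submodule.nontrivial_iff_ne_bot.mpr hV'
  -- The lift of `recipProd F V'` is its image under the section: the product of the `1/v` over `v ∈
  -- V' ∖ {0}`, formed in `R_V`.
  have h := isImmersion_awayι_extendByZero V' (card_pos F V')
    (recipExtend_mem V' (recipProd_mem F V')) (recipProd_mem F V') (by
      have : Finite V' := Module.finite_of_finite F
      have := Fintype.ofFinite {v : V' // v ≠ 0}
      simp only [recipProd_eq_prod, map_prod, recipExtend_recip, recipRestrict_recip_coe])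
  have h2 : stratumMap V' hV' = Spec.map (CommRingCat.ofHom (awayToLocZero F V')) ≫
      (Proj.awayι (recipGrading F V') _ (recipProd_mem F V') (card_pos F V') ≫
        extendByZero V') := by
    unfold stratumMap omegaToQ
    rw [Category.assoc]
  rw [h2]
  infer_instance

theorem stratum_eq_image (V' : {V' : Submodule F V // V' ≠ ⊥}) :
    stratum V' = extendByZero V'.1 ''
      (Proj.basicOpen (recipGrading F V'.1) (recipProd F V'.1) : Set (QScheme F V'.1)) := by
  have : Nontrivial V'.1 := Submodule.nontrivial_iff_ne_bot.mpr V'.2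
  rw [← range_omegaToQ, ← Set.range_comp]
  rfl

theorem mem_stratum_iff (V' : {V' : Submodule F V // V' ≠ ⊥}) (x : QScheme F V) :
    x ∈ stratum V' ↔ support x = V'.1 := by
  -- Only the inclusion `V' ≤ support` is at stake here; the opposite one holds for every point in
  -- the image of `Q_{V'}`.
  have key (p : QScheme F V'.1) : recipProd F V'.1 ∉ p.asHomogeneousIdeal ↔
      V'.1 ≤ support (extendByZero V'.1 p : QScheme F V) := by
    refine (recipProd_notMem_iff (V := V'.1) p).trans ?_
    constructor
    · intro h v hv hv0
      rw [mem_extendByZero, recipRestrict_recip_coe V'.1 ⟨v, hv⟩]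
      exact h _ fun h => hv0 (congrArg Subtype.val h)
    · intro h w hw
      have := h w.2 fun h => hw (Subtype.ext h)
      rwa [mem_extendByZero, recipRestrict_recip_coe] at this
  rw [stratum_eq_image]
  constructor
  · rintro ⟨p, hp, rfl⟩
    exact le_antisymm (support_extendByZero_le _ _) ((key p).mp hp)
  · intro hx
    obtain ⟨p, rfl⟩ := exists_extendByZero_eq hx.le
    exact ⟨p, (key p).mpr hx.ge, rfl⟩

theorem closure_stratum (V' : {V' : Submodule F V // V' ≠ ⊥}) :
    closure (stratum V') = {x : QScheme F V | support x ≤ V'.1} := by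
  have : Nontrivial V'.1 := Submodule.nontrivial_iff_ne_bot.mpr V'.2
  refine (closure_minimal (fun x hx => ((mem_stratum_iff V' x).mp hx).le)
    (isClosed_setOf_support_le V'.1)).antisymm fun x hx => ?_
  -- The generic point is the zero ideal, and `recipProd` is non-zero.
  have hη : extendByZero V'.1 (genericPoint F V'.1) ∈ stratum V' := by
    rw [stratum_eq_image]
    exact ⟨genericPoint F V'.1, recipProd_ne_zero (F := F) (V := V'.1), rfl⟩
  refine closure_mono (Set.singleton_subset_iff.mpr hη) ?_
  -- The image of the generic point is the kernel of `recipRestrict`; if `y` restricts to zero, then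
  -- the difference of `y` and its round trip through `R_{V'}` is `y` up to sign, hence `y ∈ x`.
  refine (ProjectiveSpectrum.le_iff_mem_closure (𝒜 := recipGrading F V) _ _).mp fun y hy => ?_
  have hy0 : recipRestrict V'.1 y = 0 := hy
  have h := extend_restrict_sub_mem_of_support_le hx (y := y)
  rw [hy0, map_zero, zero_sub] at h
  exact (neg_mem_iff (H := x.asHomogeneousIdeal.toIdeal)).mp h

end Strata

end ReciprocalVariety

theorem theorem7p2 (F : Type u) [Field F] [Finite F]
    (V : Type v) [AddCommGroup V] [Module F V] [FiniteDimensional F V] [Nontrivial V] :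
    -- each `Ω_{V'}` is a locally closed subscheme of `Q_V`
    (∀ V' : {V' : Submodule F V // V' ≠ ⊥},
      AlgebraicGeometry.IsImmersion (stratumMap V'.1 V'.2)) ∧
    -- set-theoretically, `Q_V` is the disjoint union of the `Ω_{V'}`
    (⋃ V' : {V' : Submodule F V // V' ≠ ⊥}, stratum V') = Set.univ ∧
    (∀ V' W' : {V' : Submodule F V // V' ≠ ⊥}, V' ≠ W' → Disjoint (stratum V') (stratum W')) ∧
    -- the closure of `Ω_{V'}` is the union of the `Ω_{W'}` for nonzero subspaces `W'` of `V'`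
    (∀ V' : {V' : Submodule F V // V' ≠ ⊥},
      closure (stratum V') =
        ⋃ (W' : {W' : Submodule F V // W' ≠ ⊥}) (_ : W'.1 ≤ V'.1), stratum W') := by
  refine ⟨fun V' => isImmersion_stratumMap V'.1 V'.2, ?_, ?_, fun V' => ?_⟩
  · refine Set.eq_univ_of_forall fun x => Set.mem_iUnion.mpr ⟨⟨support x, support_ne_bot x⟩, ?_⟩
    exact (mem_stratum_iff _ _).mpr rfl
  · intro V' W' hne
    refine Set.disjoint_left.mpr fun x hx hx' => hne (Subtype.ext ?_)
    exact ((mem_stratum_iff _ _).mp hx).symm.trans ((mem_stratum_iff _ _).mp hx')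
  · rw [closure_stratum]
    ext x
    simp only [Set.mem_iUnion, mem_stratum_iff]
    exact ⟨fun h => ⟨⟨support x, support_ne_bot x⟩, h, rfl⟩,
      fun ⟨W', hW', hx⟩ => hx.trans_le hW'⟩
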